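/- Let $(M,g)$ be a compact smooth Riemannian manifold (without boundary) of dimension $n\ge 3$, with Ricci tensor $\mathrm{Ric}$ and scalar curvature $R$. Let $\alpha,\beta,\lambda,\mu\in\mathbb{R}$ and let $f:M\to\mathbb{R}$ be a smooth function such that $(M,g)$ is a generalized gradient Ricci–Yamabe soliton with potential function $f$, that is, $$\alpha\,\mathrm{Ric}+\nabla^2 f+\Bigl(\lambda-\frac{\beta}{2}R\Bigr)g+\mu\,df\otimes df=0 \quad\text{on } M.$$ Suppose that $n\beta>2\alpha$ and that $R(p)=f(p)$ at every point $p\in M$ at which $f$ attains its maximum or its minimum over $M$. Then (i) the scalar curvature is constant, $R\equiv\dfrac{2n\lambda}{n\beta-2\alpha}$; (ii) the soliton is trivial, that is, $f$ is constant. -/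

import Mathlib

open scoped Manifold ContDiff

noncomputable section

/-! ### Riemannian geometry in coordinates

Here `G` is the matrix `(g_{ij})` of a metric on (an open subset of) `ℝⁿ`. -/

namespace CoordRiemann

variable {n : ℕ}

/-- The partial derivative `∂_i F` at `y`. -/
def partialDeriv (i : Fin n) (F : EuclideanSpace ℝ (Fin n) → ℝ)
    (y : EuclideanSpace ℝ (Fin n)) : ℝ :=
  fderiv ℝ F y (EuclideanSpace.single i 1)

/-- The Christoffel symbol
`Γ^k_{ij} = ½ ∑_l g^{kl} (∂_i g_{jl} + ∂_j g_{il} - ∂_l g_{ij})` of the Levi-Civita connection,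
so that `∇_{∂_i} ∂_j = ∑_k Γ^k_{ij} ∂_k`. -/
def christoffel (G : EuclideanSpace ℝ (Fin n) → Matrix (Fin n) (Fin n) ℝ) (k i j : Fin n)
    (y : EuclideanSpace ℝ (Fin n)) : ℝ :=
  (1 / 2 : ℝ) * ∑ l, (G y)⁻¹ k l *
    (partialDeriv i (fun z => G z j l) y + partialDeriv j (fun z => G z i l) y
      - partialDeriv l (fun z => G z i j) y)

/-- The component `R^l_{kij}` of the curvature tensor, that is, the coefficient of `∂_l` in
`∇_{∂_i} ∇_{∂_j} ∂_k - ∇_{∂_j} ∇_{∂_i} ∂_k`. -/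
def riemann (G : EuclideanSpace ℝ (Fin n) → Matrix (Fin n) (Fin n) ℝ) (l k i j : Fin n)
    (y : EuclideanSpace ℝ (Fin n)) : ℝ :=
  partialDeriv i (christoffel G l j k) y - partialDeriv j (christoffel G l i k) y
    + ∑ m, (christoffel G l i m y * christoffel G m j k y
      - christoffel G l j m y * christoffel G m i k y)

/-- The component `R_{jk} = ∑_i R^i_{kij}` of the Ricci tensor, the trace of
`X ↦ R(X, ∂_j) ∂_k` (positive on round spheres of dimension at least two). -/
def ricci (G : EuclideanSpace ℝ (Fin n) → Matrix (Fin n) (Fin n) ℝ) (j k : Fin n)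
    (y : EuclideanSpace ℝ (Fin n)) : ℝ :=
  ∑ i, riemann G i k i j y

/-- The scalar curvature `R = ∑_{j,k} g^{jk} R_{jk}`. -/
def scalar (G : EuclideanSpace ℝ (Fin n) → Matrix (Fin n) (Fin n) ℝ)
    (y : EuclideanSpace ℝ (Fin n)) : ℝ :=
  ∑ j, ∑ k, (G y)⁻¹ j k * ricci G j k y

/-- The component `∇_i ∇_j F = ∂_i ∂_j F - ∑_k Γ^k_{ij} ∂_k F` of the Hessian of `F`. -/
def hessian (G : EuclideanSpace ℝ (Fin n) → Matrix (Fin n) (Fin n) ℝ)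
    (F : EuclideanSpace ℝ (Fin n) → ℝ) (i j : Fin n) (y : EuclideanSpace ℝ (Fin n)) : ℝ :=
  partialDeriv i (partialDeriv j F) y - ∑ k, christoffel G k i j y * partialDeriv k F y

end CoordRiemann

/-! ### Riemannian manifolds -/

/-- Smooth Riemannian metrics on a smooth `n`-dimensional manifold `M` without boundary. -/
abbrev SmoothMetric (n : ℕ) (M : Type*) [TopologicalSpace M]
    [ChartedSpace (EuclideanSpace ℝ (Fin n)) M] [IsManifold (𝓡 n) ∞ M] :=
  Bundle.ContMDiffRiemannianMetric (𝓡 n) ∞ (EuclideanSpace ℝ (Fin n))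
    (fun x : M => TangentSpace (𝓡 n) x)

namespace SmoothMetric

variable {n : ℕ} {M : Type*} [TopologicalSpace M] [ChartedSpace (EuclideanSpace ℝ (Fin n)) M]

variable (n) in
/-- The coordinate vector field `∂_i` of the chart around `c`, at the point with coordinates `y`. -/
def coordVector (c : M) (i : Fin n) (y : EuclideanSpace ℝ (Fin n)) :
    TangentSpace (𝓡 n) ((extChartAt (𝓡 n) c).symm y) :=
  mfderiv 𝓘(ℝ, EuclideanSpace ℝ (Fin n)) (𝓡 n) (extChartAt (𝓡 n) c).symm y
    (EuclideanSpace.single i (1 : ℝ) : EuclideanSpace ℝ (Fin n))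

/-- The `i`-th component of the tangent vector `v` at `x` in the chart around `x`. -/
def coord (x : M) (i : Fin n) (v : TangentSpace (𝓡 n) x) : ℝ :=
  let u : EuclideanSpace ℝ (Fin n) :=
    mfderiv (𝓡 n) 𝓘(ℝ, EuclideanSpace ℝ (Fin n)) (extChartAt (𝓡 n) x) x v
  u i

variable [IsManifold (𝓡 n) ∞ M]

/-- The matrix `g_{ij} = g(∂_i, ∂_j)` of the metric in the chart around `c`. -/
def coeff (g : SmoothMetric n M) (c : M) (y : EuclideanSpace ℝ (Fin n)) :
    Matrix (Fin n) (Fin n) ℝ :=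
  Matrix.of fun i j =>
    g.inner ((extChartAt (𝓡 n) c).symm y) (coordVector n c i y) (coordVector n c j y)

/-- The Ricci tensor of `g` at `x`, as a function of two tangent vectors; like all tensors it may be
computed in any chart around `x`, and is computed in the preferred one. -/
def ricci (g : SmoothMetric n M) (x : M) (v w : TangentSpace (𝓡 n) x) : ℝ :=
  ∑ i, ∑ j, CoordRiemann.ricci (g.coeff x) i j (extChartAt (𝓡 n) x x) * coord x i v * coord x j w

/-- The scalar curvature of `g` at `x`, the trace of the Ricci tensor. -/
def scalarCurvature (g : SmoothMetric n M) (x : M) : ℝ :=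
  CoordRiemann.scalar (g.coeff x) (extChartAt (𝓡 n) x x)

/-- The Hessian `∇²f` at `x`, as a function of two tangent vectors. -/
def hessian (g : SmoothMetric n M) (f : M → ℝ) (x : M) (v w : TangentSpace (𝓡 n) x) : ℝ :=
  ∑ i, ∑ j, CoordRiemann.hessian (g.coeff x) (f ∘ (extChartAt (𝓡 n) x).symm) i j
    (extChartAt (𝓡 n) x x) * coord x i v * coord x j w

/-- The differential `df` at `x`, as a function of a tangent vector. -/
def differential (f : M → ℝ) (x : M) (v : TangentSpace (𝓡 n) x) : ℝ :=
  (mfderiv (𝓡 n) 𝓘(ℝ, ℝ) f x v : ℝ)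

end SmoothMetric

/-- `(M, g)` is a generalized gradient Ricci-Yamabe soliton with smooth potential function `f` and
constants `α, β, lam, μ`:
`α Ric + ∇²f + (lam - β/2 R) g + μ df ⊗ df = 0`. -/
structure IsGenGradRicciYamabeSoliton {n : ℕ} {M : Type*} [TopologicalSpace M]
    [ChartedSpace (EuclideanSpace ℝ (Fin n)) M] [IsManifold (𝓡 n) ∞ M]
    (g : SmoothMetric n M) (f : M → ℝ) (α β lam μ : ℝ) : Prop where
  smooth : ContMDiff (𝓡 n) 𝓘(ℝ, ℝ) ∞ f
  eqn : ∀ (x : M) (v w : TangentSpace (𝓡 n) x),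
    α * g.ricci x v w + g.hessian f x v w
      + (lam - β / 2 * g.scalarCurvature x) * g.inner x v w
      + μ * (SmoothMetric.differential f x v * SmoothMetric.differential f x w) = 0

/-- A soliton is trivial if its potential function is constant. -/
def IsTrivialPotential {M : Type*} (f : M → ℝ) : Prop :=
  ∃ c : ℝ, ∀ x, f x = c

end

/-! At an extremum of `f` the `μ` term vanishes, and tracing the soliton equation gives `(nβ - 2α) R
= 2nλ + 2Δf`. Put `c = 2nλ / (nβ - 2α)`. Since `Δf ≤ 0` at a maximum `p` and `Δf ≥ 0` at a minimum
`q`, `R(p) ≤ c ≤ R(q)`. As `R = f` at both points, `max f ≤ c ≤ min f`, so `f ≡ c`; every point is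
then an extremum, and `R = f = c` everywhere. The work lies in `trace_eq_zero` and in the sign of
the Laplacian, `laplacian_nonneg_of_isLocalMin`. -/

/-- `A` is a sum of rank-one matrices `b bᵀ`, and pairing `b bᵀ` with `H` evaluates the quadratic
form of `H` at `b`. -/
theorem Matrix.PosSemidef.sum_mul_nonneg_of_quadratic {ι : Type*} [Fintype ι]
    {A H : Matrix ι ι ℝ} (hA : A.PosSemidef)
    (hH : ∀ a : ι → ℝ, 0 ≤ ∑ i, ∑ j, a i * a j * H i j) :
    0 ≤ ∑ i, ∑ j, A i j * H i j := by
  obtain ⟨m, B, rfl⟩ := Matrix.posSemidef_iff_eq_sum_vecMulVec.mp hA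
  have key : ∑ i, ∑ j, (∑ k, Matrix.vecMulVec (B k) (star (B k))) i j * H i j
      = ∑ k, ∑ i, ∑ j, B k i * B k j * H i j := by
    simp only [Matrix.sum_apply, Matrix.vecMulVec_apply, star_trivial,
      Finset.sum_mul]
    refine Eq.trans ?_ Finset.sum_comm
    exact Finset.sum_congr rfl fun i _ => Finset.sum_comm
  rw [key]
  exact Finset.sum_nonneg fun k _ => hH (B k)

/-- Were the second derivative negative, `t` would also be a local maximum, so `φ` would be locally
constant. -/
theorem IsLocalMin.deriv_deriv_nonneg {φ : ℝ → ℝ} {t : ℝ} (h : IsLocalMin φ t)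
    (hc : ContinuousAt φ t) : 0 ≤ deriv (deriv φ) t := by
  by_contra! hneg
  have hmax := isLocalMax_of_deriv_deriv_neg hneg h.deriv_eq_zero hc
  have hconst : φ =ᶠ[nhds t] fun _ => φ t := by
    filter_upwards [h, hmax] with s h₁ h₂ using le_antisymm h₂ h₁
  have : deriv (deriv φ) t = 0 := by
    rw [hconst.deriv.deriv_eq]; simp
  exact hneg.ne this

/-! ### Sign of the Laplacian at local extrema, in coordinates -/

namespace CoordRiemann

variable {n : ℕ}

theorem fderiv_apply_eq_sum_partialDeriv (F : EuclideanSpace ℝ (Fin n) → ℝ)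
    (y a : EuclideanSpace ℝ (Fin n)) :
    fderiv ℝ F y a = ∑ i, a i * partialDeriv i F y := by
  conv_lhs => rw [← (EuclideanSpace.basisFun (Fin n) ℝ).sum_repr a]
  simp [partialDeriv]

/-- Restrict `F` to the line through `y` with direction `a` and apply the one-variable test. -/
theorem sum_partialDeriv_partialDeriv_nonneg {F : EuclideanSpace ℝ (Fin n) → ℝ}
    {y : EuclideanSpace ℝ (Fin n)} (hF : ContDiffAt ℝ 2 F y) (hmin : IsLocalMin F y)
    (a : Fin n → ℝ) :
    0 ≤ ∑ i, ∑ j, a i * a j * partialDeriv i (partialDeriv j F) y := by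
  set v : EuclideanSpace ℝ (Fin n) := WithLp.toLp 2 a with hv
  let γ : ℝ → EuclideanSpace ℝ (Fin n) := fun t => y + t • v
  have hγ : ∀ t, HasDerivAt γ v t := fun t => by
    simpa [γ] using ((hasDerivAt_id t).smul_const v).const_add y
  have hγ0 : γ 0 = y := by simp [γ]
  have hγc : Filter.Tendsto γ (nhds 0) (nhds y) := by
    have := (hγ 0).continuousAt.tendsto
    rwa [hγ0] at this
  have hd : ∀ᶠ z in nhds y, DifferentiableAt ℝ F z :=
    (hF.eventually (by simp)).mono fun z hz => hz.differentiableAt (by simp)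
  have hd2 : DifferentiableAt ℝ (fderiv ℝ F) y :=
    (hF.fderiv_right (m := 1) (by norm_num)).differentiableAt (by simp)
  have h1 : deriv (F ∘ γ) =ᶠ[nhds 0] fun t => fderiv ℝ F (γ t) v := by
    filter_upwards [hγc.eventually hd] with t ht
    exact (ht.hasFDerivAt.comp_hasDerivAt t (hγ t)).deriv
  have hpd : ∀ j, DifferentiableAt ℝ (partialDeriv j F) y := fun j =>
    hd2.clm_apply (differentiableAt_const _)
  have h2 : deriv (deriv (F ∘ γ)) 0
      = ∑ i, ∑ j, a i * a j * partialDeriv i (partialDeriv j F) y := by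
    rw [h1.deriv_eq]
    have : HasFDerivAt (fun z => fderiv ℝ F z v)
        (∑ j, a j • fderiv ℝ (partialDeriv j F) y) (γ 0) := by
      rw [hγ0]
      simp only [fderiv_apply_eq_sum_partialDeriv]
      exact HasFDerivAt.fun_sum fun j _ => (hpd j).hasFDerivAt.const_mul (a j)
    refine (this.comp_hasDerivAt (0 : ℝ) (hγ 0)).deriv.trans ?_
    rw [sum_apply,
      Finset.sum_comm]
    refine Finset.sum_congr rfl fun j _ => ?_
    rw [smul_apply, fderiv_apply_eq_sum_partialDeriv, smul_eq_mul,
      Finset.mul_sum]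
    exact Finset.sum_congr rfl fun i _ => by simp [hv]; ring
  rw [← h2]
  refine IsLocalMin.deriv_deriv_nonneg ?_ ?_
  · rw [← hγ0] at hmin
    exact hmin.comp_continuous (hγ 0).continuousAt
  · refine ContinuousAt.comp ?_ (hγ 0).continuousAt
    rw [hγ0]; exact hF.continuousAt

theorem partialDeriv_eq_zero_of_isLocalExtr {F : EuclideanSpace ℝ (Fin n) → ℝ}
    {y : EuclideanSpace ℝ (Fin n)} (h : IsLocalExtr F y) (i : Fin n) :
    partialDeriv i F y = 0 := by
  simp [partialDeriv, h.fderiv_eq_zero]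

theorem partialDeriv_neg (i : Fin n) (F : EuclideanSpace ℝ (Fin n) → ℝ) :
    partialDeriv i (-F) = -partialDeriv i F := by
  funext y
  simp [partialDeriv, fderiv_neg]

theorem hessian_neg (G : EuclideanSpace ℝ (Fin n) → Matrix (Fin n) (Fin n) ℝ)
    (F : EuclideanSpace ℝ (Fin n) → ℝ) (i j : Fin n) (y : EuclideanSpace ℝ (Fin n)) :
    hessian G (-F) i j y = -hessian G F i j y := by
  simp only [hessian, partialDeriv_neg, Pi.neg_apply, mul_neg, Finset.sum_neg_distrib]
  ring

/-- The Laplacian of `F` is nonnegative at a local minimum. -/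
theorem laplacian_nonneg_of_isLocalMin
    {G : EuclideanSpace ℝ (Fin n) → Matrix (Fin n) (Fin n) ℝ}
    {F : EuclideanSpace ℝ (Fin n) → ℝ} {y : EuclideanSpace ℝ (Fin n)} (hG : (G y).PosDef)
    (hF : ContDiffAt ℝ 2 F y) (hmin : IsLocalMin F y) :
    0 ≤ ∑ i, ∑ j, (G y)⁻¹ i j * hessian G F i j y := by
  refine hG.inv.posSemidef.sum_mul_nonneg_of_quadratic
    (H := Matrix.of fun i j => hessian G F i j y) fun a => ?_
  -- At a critical point the Christoffel terms drop out of the Hessian.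
  simpa [hessian, partialDeriv_eq_zero_of_isLocalExtr (.inl hmin)] using
    sum_partialDeriv_partialDeriv_nonneg hF hmin a

/-- The Laplacian of `F` is nonpositive at a local maximum. -/
theorem laplacian_nonpos_of_isLocalMax
    {G : EuclideanSpace ℝ (Fin n) → Matrix (Fin n) (Fin n) ℝ}
    {F : EuclideanSpace ℝ (Fin n) → ℝ} {y : EuclideanSpace ℝ (Fin n)} (hG : (G y).PosDef)
    (hF : ContDiffAt ℝ 2 F y) (hmax : IsLocalMax F y) :
    ∑ i, ∑ j, (G y)⁻¹ i j * hessian G F i j y ≤ 0 := by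
  have h := laplacian_nonneg_of_isLocalMin (F := -F) hG hF.neg hmax.neg
  simpa [hessian_neg] using h

end CoordRiemann

/-! ### Tensors at the centre of a chart -/

namespace SmoothMetric

variable {n : ℕ} {M : Type*} [TopologicalSpace M] [ChartedSpace (EuclideanSpace ℝ (Fin n)) M]

/-- The coordinate vector field `∂_i` of the chart around `x`, at `x` itself. -/
noncomputable def coordBasis (x : M) (i : Fin n) : TangentSpace (𝓡 n) x :=
  (coordVector n x i (extChartAt (𝓡 n) x x) : EuclideanSpace ℝ (Fin n))

/-- The differential at `x` of the chart around `x`, as a map into the model space. -/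
noncomputable def coordinates (x : M) :
    TangentSpace (𝓡 n) x →L[ℝ] EuclideanSpace ℝ (Fin n) :=
  mfderiv (𝓡 n) 𝓘(ℝ, EuclideanSpace ℝ (Fin n)) (extChartAt (𝓡 n) x) x

theorem coord_eq_coordinates (x : M) (i : Fin n) (v : TangentSpace (𝓡 n) x) :
    coord x i v = coordinates x v i := rfl

section

variable [IsManifold (𝓡 n) ∞ M]

theorem coord_coordBasis (x : M) (i j : Fin n) :
    coord x i (coordBasis x j) = if i = j then 1 else 0 := by
  have : IsManifold (𝓡 n) 1 M := IsManifold.of_le (n := ∞) (by simp)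
  have h := mfderiv_extChartAt_comp_mfderivWithin_extChartAt_symm' (I := 𝓡 n)
    (mem_extChartAt_source (I := 𝓡 n) x)
  have h' := congrArg (fun L => L (EuclideanSpace.single j (1 : ℝ) : EuclideanSpace ℝ (Fin n))) h
  simp only [ModelWithCorners.range_eq_univ, mfderivWithin_univ] at h'
  have h'' : coordinates x (coordBasis x j) = EuclideanSpace.single j 1 := h'
  rw [coord_eq_coordinates, h'']
  simp

/-- The base point on the left is `x` only propositionally; all tangent spaces being the model
space, the vectors can be held fixed while the point is replaced. -/
theorem coeff_apply_self (g : SmoothMetric n M) (x : M) (i j : Fin n) :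
    g.coeff x (extChartAt (𝓡 n) x x) i j = g.inner x (coordBasis x i) (coordBasis x j) := by
  have key : ∀ (z : M) (_ : z = x) (v w : EuclideanSpace ℝ (Fin n)),
      g.inner z (v : TangentSpace (𝓡 n) z) (w : TangentSpace (𝓡 n) z)
        = g.inner x (v : TangentSpace (𝓡 n) x) (w : TangentSpace (𝓡 n) x) := by
    rintro z rfl v w; rfl
  exact key _ (extChartAt_to_inv (I := 𝓡 n) x) _ _

theorem posDef_coeff_self (g : SmoothMetric n M) (x : M) :
    (g.coeff x (extChartAt (𝓡 n) x x)).PosDef := by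
  refine .of_dotProduct_mulVec_pos ?_ fun {a} ha => ?_
  · ext i j
    simp only [Matrix.conjTranspose_apply, star_trivial, coeff_apply_self]
    exact g.symm _ _ _
  · set v : TangentSpace (𝓡 n) x := ∑ i, a i • coordBasis x i with hv
    have hcoord : ∀ i, coord x i v = a i := fun i => by
      have : coord x i v = ∑ j, a j * coord x i (coordBasis x j) := by
        simp [coord_eq_coordinates, hv]
      simp [this, coord_coordBasis]
    have hv0 : v ≠ 0 := fun h => ha <| funext fun i => by
      rw [← hcoord i, h]; simp [coord_eq_coordinates]
    have := g.pos x v hv0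
    convert! this using 1
    simp only [dotProduct, Matrix.mulVec, hv, map_sum, map_smul, coeff_apply_self,
      sum_apply, smul_apply, smul_eq_mul, Finset.mul_sum]
    refine Finset.sum_congr rfl fun i _ => Finset.sum_congr rfl fun j _ => ?_
    rw [g.symm x (coordBasis x j), Pi.star_apply, star_trivial]
    ring

theorem ricci_coordBasis (g : SmoothMetric n M) (x : M) (i j : Fin n) :
    g.ricci x (coordBasis x i) (coordBasis x j)
      = CoordRiemann.ricci (g.coeff x) i j (extChartAt (𝓡 n) x x) := by
  simp [ricci, coord_coordBasis]

theorem hessian_coordBasis (g : SmoothMetric n M) (f : M → ℝ) (x : M) (i j : Fin n) :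
    g.hessian f x (coordBasis x i) (coordBasis x j)
      = CoordRiemann.hessian (g.coeff x) (f ∘ (extChartAt (𝓡 n) x).symm) i j
        (extChartAt (𝓡 n) x x) := by
  simp [hessian, coord_coordBasis]

end

theorem differential_eq_zero_of_isExtrOn {f : M → ℝ} {x : M} (h : IsExtrOn f Set.univ x)
    (v : TangentSpace (𝓡 n) x) : differential f x v = 0 := by
  have hw : writtenInExtChartAt (𝓡 n) 𝓘(ℝ, ℝ) x f = f ∘ (extChartAt (𝓡 n) x).symm := rfl
  -- The extremum is global, so the inequality holds at every `z`, even outside the chart's target.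
  have hF : IsLocalExtr (writtenInExtChartAt (𝓡 n) 𝓘(ℝ, ℝ) x f) (extChartAt (𝓡 n) x x) := by
    rcases h with h | h
    · exact .inl (.of_forall fun z => by
        rw [hw, Function.comp_apply, Function.comp_apply, extChartAt_to_inv]
        exact h (Set.mem_univ _))
    · exact .inr (.of_forall fun z => by
        rw [hw, Function.comp_apply, Function.comp_apply, extChartAt_to_inv]
        exact h (Set.mem_univ _))
  by_cases hf : MDifferentiableAt (𝓡 n) 𝓘(ℝ, ℝ) f x
  · rw [differential, hf.mfderiv, ModelWithCorners.range_eq_univ, fderivWithin_univ, hF.fderiv_eq_zero]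
    rfl
  · rw [differential, mfderiv_zero_of_not_mdifferentiableAt hf]
    rfl

theorem contDiffAt_comp_extChartAt_symm {f : M → ℝ} [IsManifold (𝓡 n) ∞ M]
    (hf : ContMDiff (𝓡 n) 𝓘(ℝ, ℝ) ∞ f) (x : M) :
    ContDiffAt ℝ ∞ (f ∘ (extChartAt (𝓡 n) x).symm) (extChartAt (𝓡 n) x x) := by
  have := (contMDiffAt_iff.mp (hf x)).2
  rw [ModelWithCorners.range_eq_univ, contDiffWithinAt_univ] at this
  exact this

end SmoothMetric

/-! ### The traced soliton equation and the bounds on `R` -/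

namespace IsGenGradRicciYamabeSoliton

variable {n : ℕ} {M : Type*} [TopologicalSpace M] [ChartedSpace (EuclideanSpace ℝ (Fin n)) M]
  [IsManifold (𝓡 n) ∞ M] {g : SmoothMetric n M} {f : M → ℝ} {α β lam μ : ℝ}

/-- The trace of the soliton equation at an extremum of the potential function, where the
differential of the potential function vanishes. -/
theorem trace_eq_zero (h : IsGenGradRicciYamabeSoliton g f α β lam μ) {x : M}
    (hx : IsExtrOn f Set.univ x) :
    α * g.scalarCurvature x
      + ∑ i, ∑ j, (g.coeff x (extChartAt (𝓡 n) x x))⁻¹ i j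
        * CoordRiemann.hessian (g.coeff x) (f ∘ (extChartAt (𝓡 n) x).symm) i j
          (extChartAt (𝓡 n) x x)
      + (lam - β / 2 * g.scalarCurvature x) * n = 0 := by
  set y := extChartAt (𝓡 n) x x with hy
  set G := g.coeff x y with hG
  have hpos : G.PosDef := g.posDef_coeff_self x
  have htr : ∑ i, ∑ j, G⁻¹ i j * G i j = n := by
    have h1 : G⁻¹ * G = 1 := Matrix.nonsing_inv_mul _ (G.isUnit_iff_isUnit_det.mp hpos.isUnit)
    have h2 := congrArg Matrix.trace h1
    rw [Matrix.trace_one, Fintype.card_fin] at h2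
    rw [← h2, Matrix.trace]
    refine Finset.sum_congr rfl fun i _ => ?_
    rw [Matrix.diag_apply, Matrix.mul_apply]
    -- The trace of `G⁻¹ * G` pairs with `G j i`; symmetry of `G` swaps the indices.
    exact Finset.sum_congr rfl fun j _ => by
      rw [← hpos.isHermitian.apply i j]; simp
  have heq : ∀ i j, α * CoordRiemann.ricci (g.coeff x) i j y
      + CoordRiemann.hessian (g.coeff x) (f ∘ (extChartAt (𝓡 n) x).symm) i j y
      + (lam - β / 2 * g.scalarCurvature x) * G i j = 0 := fun i j => by
    have := h.eqn x (SmoothMetric.coordBasis x i) (SmoothMetric.coordBasis x j)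
    rw [SmoothMetric.ricci_coordBasis, SmoothMetric.hessian_coordBasis,
      SmoothMetric.differential_eq_zero_of_isExtrOn hx, ← SmoothMetric.coeff_apply_self] at this
    rwa [zero_mul, mul_zero, add_zero] at this
  have hS : g.scalarCurvature x = ∑ i, ∑ j, G⁻¹ i j * CoordRiemann.ricci (g.coeff x) i j y := rfl
  calc _ = ∑ i, ∑ j, G⁻¹ i j * (α * CoordRiemann.ricci (g.coeff x) i j y
      + CoordRiemann.hessian (g.coeff x) (f ∘ (extChartAt (𝓡 n) x).symm) i j y
      + (lam - β / 2 * g.scalarCurvature x) * G i j) := by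
        rw [← htr]
        conv_lhs => enter [1, 1]; rw [hS]
        simp only [mul_add, Finset.sum_add_distrib, Finset.mul_sum, mul_left_comm]
    _ = 0 := by simp only [heq, mul_zero, Finset.sum_const_zero]

theorem scalarCurvature_ge_of_isMinOn (h : IsGenGradRicciYamabeSoliton g f α β lam μ)
    (hαβ : 2 * α < n * β) {x : M} (hx : IsMinOn f Set.univ x) :
    2 * n * lam / (n * β - 2 * α) ≤ g.scalarCurvature x := by
  have htr := h.trace_eq_zero (.inl hx)
  have hlap := CoordRiemann.laplacian_nonneg_of_isLocalMin (g.posDef_coeff_self x)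
    ((SmoothMetric.contDiffAt_comp_extChartAt_symm h.smooth x).of_le ENat.LEInfty.out)
    (.of_forall fun z => by
      rw [Function.comp_apply, Function.comp_apply, extChartAt_to_inv]
      exact hx (Set.mem_univ _))
  rw [div_le_iff₀ (by linarith)]
  linarith

theorem scalarCurvature_le_of_isMaxOn (h : IsGenGradRicciYamabeSoliton g f α β lam μ)
    (hαβ : 2 * α < n * β) {x : M} (hx : IsMaxOn f Set.univ x) :
    g.scalarCurvature x ≤ 2 * n * lam / (n * β - 2 * α) := by
  have htr := h.trace_eq_zero (.inr hx)
  have hlap := CoordRiemann.laplacian_nonpos_of_isLocalMax (g.posDef_coeff_self x)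
    ((SmoothMetric.contDiffAt_comp_extChartAt_symm h.smooth x).of_le ENat.LEInfty.out)
    (.of_forall fun z => by
      rw [Function.comp_apply, Function.comp_apply, extChartAt_to_inv]
      exact hx (Set.mem_univ _))
  rw [le_div_iff₀ (by linarith)]
  linarith

end IsGenGradRicciYamabeSoliton

theorem proposition1p1 {n : ℕ} (hn : 3 ≤ n) {M : Type*} [TopologicalSpace M] [T2Space M]
    [CompactSpace M] [ChartedSpace (EuclideanSpace ℝ (Fin n)) M] [IsManifold (𝓡 n) ∞ M]
    (g : SmoothMetric n M) (f : M → ℝ) (α β lam μ : ℝ)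
    (hsol : IsGenGradRicciYamabeSoliton g f α β lam μ)
    (hαβ : 2 * α < n * β)
    (hextr : ∀ p : M, IsExtrOn f Set.univ p → g.scalarCurvature p = f p) :
    (∀ x : M, g.scalarCurvature x = 2 * n * lam / (n * β - 2 * α)) ∧ IsTrivialPotential f := by
  rcases isEmpty_or_nonempty M with hM | hM
  · exact ⟨fun x => hM.elim x, 0, fun x => hM.elim x⟩
  have hc : ContinuousOn f Set.univ := hsol.smooth.continuous.continuousOn
  obtain ⟨p, -, hp⟩ := isCompact_univ.exists_isMaxOn Set.univ_nonempty hc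
  obtain ⟨q, -, hq⟩ := isCompact_univ.exists_isMinOn Set.univ_nonempty hc
  have hfp := hsol.scalarCurvature_le_of_isMaxOn hαβ hp
  have hfq := hsol.scalarCurvature_ge_of_isMinOn hαβ hq
  rw [hextr p (.inr hp)] at hfp
  rw [hextr q (.inl hq)] at hfq
  have hconst : ∀ x, f x = 2 * n * lam / (n * β - 2 * α) := fun x =>
    le_antisymm ((hp (Set.mem_univ x)).trans hfp) (hfq.trans (hq (Set.mem_univ x)))
  refine ⟨fun x => ?_, _, hconst⟩
  -- Since `f` is constant, every `x` is a minimum point and `hextr` applies to it.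
  rw [hextr x (.inl fun z _ => ((hconst x).trans (hconst z).symm).le), hconst]
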